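/- Let $D$ be a set of cardinality $\aleph_1$, and let $L=D\cup\{x_0\}$, with $x_0\notin D$, be the one-point Lindelöfication of the discrete space $D$: every point of $D$ is isolated in $L$, and the sets $L\setminus C$, with $C$ a countable subset of $D$, form a local base at $x_0$. Let $H$ be the free abelian topological group over $L$, i.e. the free abelian group on the set $L$ with the finest group topology for which the canonical map $L\to H$ is continuous. Call an abelian topological group prodiscrete if it is Hausdorff, complete, and has a local base at the identity consisting of open subgroups, and call a topological group pro-Lie if it is topologically isomorphic to a projective limit, over a directed set, of finite-dimensional real Lie groups. Then there exist a separable abelian topological group $G$ that is both prodiscrete and pro-Lie, and a closed subgroup $K$ of $G$, such that $K$ is topologically isomorphic to $H$ and $K$ is not separable. In particular, closed subgroups of separable prodiscrete abelian groups, and closed subgroups of separable pro-Lie groups, need not be separable. -/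

import Mathlib

/-!
For a subset `C` of `D`, let `collapse C` be the endomorphism of `H` that fixes the points of `C`
and `x₀` and identifies every other generator with `x₀`, and let `tail C` be its kernel. When `C` is
countable, `tail C` is an open subgroup with countable quotient. These subgroups form a base at
zero: a neighbourhood of zero contains a subgroup which is a countable intersection of
neighbourhoods of zero, and each of these contains `d - x₀` for all but countably many `d`.

Hence the diagonal map from `H` to the product of the discrete groups `H ⧸ tail C` is an embedding.
Its range is closed because for a coherent family `x` the elements `collapse C (x C)` are eventually
constant: otherwise they would change at every step of some increasing sequence of countable sets,
while `collapse (⋃ n, C n) g = collapse (C m) g` for large `m`, as `g` involves only finitely many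
generators. There are at most continuum many countable subsets of `D`, so the product is separable
by the Hewitt–Marczewski–Pondiczery theorem. On the other hand, a countable subset of `H` is fixed
pointwise by `collapse C` for some countable `C`, so it is not dense.
-/

open scoped Manifold ContDiff

universe u

/-- The one-point Lindelöfication `D ∪ {x₀}` of the discrete set `D`; `infty` is the point `x₀`. -/
inductive OnePointLindelofication (D : Type u) : Type u
  | pt (d : D)
  | infty

/-- Every point of `D` is isolated, and the sets `L \ C`, `C` a countable subset of `D`, form a
local base at the added point. -/
instance (D : Type u) : TopologicalSpace (OnePointLindelofication D) where
  IsOpen U := .infty ∈ U → {d : D | .pt d ∉ U}.Countable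
  isOpen_univ := by
    intro _
    simp
  isOpen_inter := by
    intro s t hs ht h
    refine ((hs h.1).union (ht h.2)).mono ?_
    intro d hd
    by_cases h1 : .pt d ∈ s
    · exact Or.inr fun h2 => hd ⟨h1, h2⟩
    · exact Or.inl h1
  isOpen_sUnion := by
    intro S hS h
    obtain ⟨t, ht, hmem⟩ := h
    exact (hS t ht hmem).mono fun d hd hdt => hd ⟨t, ht, hdt⟩

/-- The underlying group of the free abelian topological group over `X`. -/
def FreeAbelianTopGroup (X : Type u) : Type u := FreeAbelianGroup X

noncomputable instance (X : Type u) : AddCommGroup (FreeAbelianTopGroup X) :=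
  inferInstanceAs (AddCommGroup (FreeAbelianGroup X))

/-- The canonical map from `X` to the free abelian topological group over `X`. -/
def FreeAbelianTopGroup.of {X : Type u} (x : X) : FreeAbelianTopGroup X :=
  FreeAbelianGroup.of x

/-- The topology of the free abelian topological group: the finest group topology for which the
canonical map from `X` is continuous. -/
noncomputable instance (X : Type u) [TopologicalSpace X] : TopologicalSpace (FreeAbelianTopGroup X) :=
  (AddGroupTopology.coinduced
    (FreeAbelianTopGroup.of : X → FreeAbelianTopGroup X)).toTopologicalSpace

instance (X : Type u) [TopologicalSpace X] : IsTopologicalAddGroup (FreeAbelianTopGroup X) :=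
  (AddGroupTopology.coinduced
    (FreeAbelianTopGroup.of : X → FreeAbelianTopGroup X)).toIsTopologicalAddGroup

/-- An abelian topological group is prodiscrete if it is Hausdorff, the open subgroups form a local
base at the identity, and it is complete in its group uniformity. -/
structure IsProdiscrete (G : Type u) [AddCommGroup G] [TopologicalSpace G]
    [IsTopologicalAddGroup G] : Prop where
  t2 : T2Space G
  nonarchimedean : NonarchimedeanAddGroup G
  complete : @CompleteSpace G (IsTopologicalAddGroup.rightUniformSpace G)

/-- A (not necessarily commutative, additively written) topological group is a finite-dimensional
real Lie group. -/
def IsFiniteDimLieGroup (A : Type u) [AddGroup A] [TopologicalSpace A] : Prop :=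
  T2Space A ∧ ∃ (n : ℕ) (_ : ChartedSpace (EuclideanSpace ℝ (Fin n)) A), LieAddGroup (𝓡 n) ∞ A

/-- A projective system of topological groups over a directed set `J`. -/
structure ProjectiveSystem (J : Type u) [Preorder J] where
  obj : J → Type u
  [addGroup : ∀ j, AddGroup (obj j)]
  [topology : ∀ j, TopologicalSpace (obj j)]
  map : ∀ {i j : J}, i ≤ j → obj j →+ obj i
  continuous_map : ∀ {i j : J} (h : i ≤ j), Continuous (map h)
  map_refl : ∀ (j : J) (x : obj j), map (le_refl j) x = x
  map_map : ∀ {i j k : J} (hij : i ≤ j) (hjk : j ≤ k) (x : obj k),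
    map hij (map hjk x) = map (hij.trans hjk) x

attribute [instance] ProjectiveSystem.addGroup ProjectiveSystem.topology

/-- The projective limit, as a subgroup of the product with the product topology. -/
def ProjectiveSystem.limit {J : Type u} [Preorder J] (S : ProjectiveSystem J) :
    AddSubgroup (∀ j, S.obj j) where
  carrier := {x | ∀ (i j : J) (h : i ≤ j), S.map h (x j) = x i}
  zero_mem' := by
    intro i j h
    simp
  add_mem' := by
    intro x y hx hy i j h
    simp [hx i j h, hy i j h]
  neg_mem' := by
    intro x hx i j h
    simp [hx i j h]

/-- A topological group (written additively) is pro-Lie if it is topologically isomorphic to a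
projective limit of finite-dimensional Lie groups. -/
def IsProLie (G : Type u) [AddGroup G] [TopologicalSpace G] : Prop :=
  ∃ (J : Type u) (_ : Preorder J) (_ : IsDirectedOrder J) (_ : Nonempty J)
    (S : ProjectiveSystem J),
    (∀ j, IsFiniteDimLieGroup (S.obj j)) ∧ Nonempty (G ≃ₜ+ S.limit)

open Cardinal Filter Set TopologicalSpace Topology

section SeparablePi

theorem exists_injOn_restrict_fin {ι α : Type*} (e : ι ↪ (ℕ → α)) (I : Finset ι) :
    ∃ n : ℕ, InjOn (fun i (k : Fin n) => e i k) I := by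
  have separated (i j : ι) (hij : i ≠ j) :
      ∀ᶠ n : ℕ in atTop, (fun k : Fin n => e i k) ≠ fun k : Fin n => e j k := by
    obtain ⟨m, hm⟩ := Function.ne_iff.mp (e.injective.ne hij)
    filter_upwards [eventually_gt_atTop m] with n hn h
    exact hm (congrFun h ⟨m, hn⟩)
  have all_separated : ∀ᶠ n : ℕ in atTop, ∀ i ∈ I, ∀ j ∈ I, i ≠ j →
      (fun k : Fin n => e i k) ≠ fun k : Fin n => e j k := by
    simp only [Finset.eventually_all, eventually_imp_distrib_left]
    exact fun i _ j _ => separated i j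
  obtain ⟨n, hn⟩ := all_separated.exists
  exact ⟨n, fun i hi j hj h => by_contra fun hij => hn i hi j hj hij h⟩

theorem separableSpace_pi_of_mk_le_continuum {ι : Type*} {X : ι → Type*}
    [∀ i, TopologicalSpace (X i)] [∀ i, SeparableSpace (X i)] (hι : #ι ≤ 𝔠) :
    SeparableSpace (∀ i, X i) := by
  rcases isEmpty_or_nonempty (∀ i, X i) with hempty | ⟨⟨x₀⟩⟩
  · infer_instance
  have (i : ι) : Nonempty (X i) := ⟨x₀ i⟩
  obtain ⟨e⟩ : Nonempty (ι ↪ (ℕ → Bool)) := lift_mk_le'.mp (by simpa using hι)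
  -- Points whose `i`-th coordinate depends only on a finite prefix of the code `e i`.
  let point (p : Σ n : ℕ, (Fin n → Bool) → ℕ) (i : ι) : X i := denseSeq (X i) (p.2 fun k => e i k)
  refine ⟨range point, countable_range point, dense_iff_inter_open.mpr ?_⟩
  rintro U hU ⟨x, hx⟩
  obtain ⟨I, u, hu, hIU⟩ := isOpen_pi_iff.mp hU x hx
  obtain ⟨n, hn⟩ := exists_injOn_restrict_fin e I
  have hdense (i : I) : ∃ k, denseSeq (X i) k ∈ u i :=
    (denseRange_denseSeq (X i)).exists_mem_open (hu i i.2).1 ⟨x i, (hu i i.2).2⟩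
  choose k hk using hdense
  let code : I → Fin n → Bool := fun i l => e i l
  have hcode : Function.Injective code := hn.injective
  refine ⟨point ⟨n, Function.extend code k 0⟩, hIU fun i hi => ?_, mem_range_self _⟩
  have hi' : Function.extend code k 0 (code ⟨i, hi⟩) = k ⟨i, hi⟩ := hcode.extend_apply k 0 ⟨i, hi⟩
  change denseSeq (X i) (Function.extend code k 0 (code ⟨i, hi⟩)) ∈ u i
  exact hi'.symm ▸ hk ⟨i, hi⟩

theorem mk_setOf_countable_le_continuum {α : Type u} (hα : #α ≤ 𝔠) :
    #{s : Set α // s.Countable} ≤ 𝔠 := by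
  simp only [← le_aleph0_iff_set_countable]
  calc #{s : Set α // #s ≤ ℵ₀} ≤ max #α ℵ₀ ^ ℵ₀ := mk_bounded_set_le α ℵ₀
    _ ≤ 𝔠 ^ ℵ₀ := power_le_power_right (max_le hα aleph0_le_continuum)
    _ = 𝔠 := continuum_power_aleph0

end SeparablePi

section Prodiscrete

theorem nonarchimedeanAddGroup_pi {ι : Type*} {X : ι → Type*} [∀ i, AddGroup (X i)]
    [∀ i, TopologicalSpace (X i)] [∀ i, NonarchimedeanAddGroup (X i)] :
    NonarchimedeanAddGroup (∀ i, X i) where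
  is_nonarchimedean U hU := by
    obtain ⟨V, hVU, hV, h0⟩ := mem_nhds_iff.mp hU
    obtain ⟨I, u, hu, hIV⟩ := isOpen_pi_iff.mp hV 0 h0
    have hsub (i : I) : ∃ W : OpenAddSubgroup (X i), (W : Set (X i)) ⊆ u i :=
      NonarchimedeanAddGroup.is_nonarchimedean _ ((hu i i.2).1.mem_nhds (hu i i.2).2)
    choose W hW using hsub
    let N : AddSubgroup (∀ i, X i) :=
      ⨅ i : I, (W i).toAddSubgroup.comap (Pi.evalAddMonoidHom X i)
    have hN : (N : Set (∀ i, X i)) = ⋂ i : I, Function.eval i.1 ⁻¹' W i := by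
      simp only [N, AddSubgroup.coe_iInf]
      rfl
    have hNopen : IsOpen (N : Set (∀ i, X i)) :=
      hN ▸ isOpen_iInter_of_finite fun i => (W i).isOpen.preimage (continuous_apply _)
    refine ⟨⟨N, hNopen⟩, fun x hx => hVU (hIV fun i hi => hW ⟨i, hi⟩ ?_)⟩
    exact mem_iInter.mp (hN ▸ hx : x ∈ ⋂ i : I, Function.eval i.1 ⁻¹' W i) ⟨i, hi⟩

theorem completeSpace_rightUniformSpace_pi {ι : Type*} {X : ι → Type*} [∀ i, AddCommGroup (X i)]
    [∀ i, TopologicalSpace (X i)] [∀ i, IsTopologicalAddGroup (X i)]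
    (hX : ∀ i, @CompleteSpace (X i) (IsTopologicalAddGroup.rightUniformSpace (X i))) :
    @CompleteSpace (∀ i, X i) (IsTopologicalAddGroup.rightUniformSpace (∀ i, X i)) := by
  let (i : ι) : UniformSpace (X i) := IsTopologicalAddGroup.rightUniformSpace (X i)
  have (i : ι) : IsUniformAddGroup (X i) := isUniformAddGroup_of_addCommGroup
  have h : IsTopologicalAddGroup.rightUniformSpace (∀ i, X i) = Pi.uniformSpace X :=
    IsUniformAddGroup.rightUniformSpace_eq
  exact h ▸ Pi.complete X

theorem IsProdiscrete.pi {ι : Type*} {X : ι → Type*} [∀ i, AddCommGroup (X i)]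
    [∀ i, TopologicalSpace (X i)] [∀ i, IsTopologicalAddGroup (X i)]
    (hX : ∀ i, IsProdiscrete (X i)) : IsProdiscrete (∀ i, X i) where
  t2 := have (i : ι) := (hX i).t2; inferInstance
  nonarchimedean := have (i : ι) := (hX i).nonarchimedean; nonarchimedeanAddGroup_pi
  complete := completeSpace_rightUniformSpace_pi fun i => (hX i).complete

theorem IsProdiscrete.of_discreteTopology {A : Type u} [AddCommGroup A] [TopologicalSpace A]
    [DiscreteTopology A] : IsProdiscrete A where
  t2 := inferInstance
  nonarchimedean :=
    ⟨fun _ hU => ⟨⟨⊥, isOpen_discrete _⟩, singleton_subset_iff.mpr (mem_of_mem_nhds hU)⟩⟩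
  complete := by
    let : UniformSpace A := IsTopologicalAddGroup.rightUniformSpace A
    have : IsUniformAddGroup A := isUniformAddGroup_of_addCommGroup
    exact IsRightUniformAddGroup.completeSpace_of_weaklyLocallyCompactSpace

end Prodiscrete

section ProLie

theorem IsFiniteDimLieGroup.of_discreteTopology (A : Type u) [AddGroup A] [TopologicalSpace A]
    [DiscreteTopology A] : IsFiniteDimLieGroup A := by
  let : ChartedSpace (EuclideanSpace ℝ (Fin 0)) A := ChartedSpace.ofDiscreteTopology
  have : IsManifold (𝓡 0) ∞ A := IsManifold.of_discreteTopology _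
  exact ⟨inferInstance, 0, inferInstance,
    { contMDiff_add := contMDiff_of_discreteTopology
      contMDiff_neg := contMDiff_of_discreteTopology }⟩

variable {ι : Type u} (X : ι → Type u) [∀ i, AddGroup (X i)] [∀ i, TopologicalSpace (X i)]

/-- The projective system of the finite subproducts of a family of topological groups, with the
restriction maps; it exhibits the full product as a projective limit. -/
def finiteSubproducts : ProjectiveSystem (Finset ι) where
  obj I := ∀ i : I, X i
  map h :=
    { toFun := fun x i => x ⟨i, h i.2⟩
      map_zero' := rfl
      map_add' := fun _ _ => rfl }
  continuous_map _ := continuous_pi fun _ => continuous_apply _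
  map_refl _ _ := rfl
  map_map _ _ _ := rfl

/-- The isomorphism of a product with the projective limit of its finite subproducts; the inverse
reads the coordinate `i` off the subproduct over `{i}`. -/
def piEquivLimitFiniteSubproducts : (∀ i, X i) ≃ₜ+ (finiteSubproducts X).limit where
  toFun x := ⟨fun _ i => x i, fun _ _ _ => rfl⟩
  invFun y i := y.1 {i} ⟨i, Finset.mem_singleton_self i⟩
  left_inv _ := rfl
  right_inv y := by
    refine Subtype.ext (funext fun I => funext fun i => ?_)
    exact (congrFun (y.2 {i.1} I (Finset.singleton_subset_iff.mpr i.2)) _).symm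
  map_add' _ _ := rfl
  continuous_toFun := Continuous.subtype_mk
    (continuous_pi fun _ => continuous_pi fun i => continuous_apply i.1) _
  continuous_invFun := continuous_pi fun i =>
    (continuous_apply (A := fun j : ({i} : Finset ι) => X j) ⟨i, Finset.mem_singleton_self i⟩).comp
      ((continuous_apply (A := fun I : Finset ι => ∀ j : I, X j) {i}).comp continuous_subtype_val)

theorem isProLie_pi_of_discreteTopology [∀ i, DiscreteTopology (X i)] : IsProLie (∀ i, X i) := by
  classical
  refine ⟨Finset ι, inferInstance, inferInstance, inferInstance, finiteSubproducts X, fun I => ?_,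
    ⟨piEquivLimitFiniteSubproducts X⟩⟩
  have : DiscreteTopology ((finiteSubproducts X).obj I) :=
    inferInstanceAs (DiscreteTopology (∀ i : I, X i))
  exact .of_discreteTopology _

end ProLie

section PiQuotient

variable {G ι : Type*} [AddCommGroup G]

/-- The diagonal homomorphism from an abelian group to the product of its quotients by a family of
subgroups. -/
def toPiQuotient (N : ι → AddSubgroup G) : G →+ ∀ i, G ⧸ N i :=
  AddMonoidHom.pi fun i => QuotientAddGroup.mk' (N i)

variable [TopologicalSpace G] [IsTopologicalAddGroup G] {N : ι → AddSubgroup G}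

theorem isInducing_toPiQuotient (hN : (𝓝 (0 : G)).HasBasis (fun _ => True) fun i => (N i : Set G)) :
    IsInducing (toPiQuotient N) := by
  have hdiscrete (i : ι) : DiscreteTopology (G ⧸ N i) :=
    QuotientAddGroup.discreteTopology ((N i).isOpen_of_mem_nhds (hN.mem_of_mem trivial))
  refine IsTopologicalAddGroup.isInducing_iff_nhds_zero.mpr (le_antisymm ?_ fun U hU => ?_)
  · have hcont : Continuous (toPiQuotient N) :=
      continuous_pi fun _ => QuotientAddGroup.continuous_mk
    simpa only [map_zero] using (hcont.tendsto 0).le_comap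
  · obtain ⟨i, -, hi⟩ := hN.mem_iff.mp hU
    have hopen : IsOpen (Function.eval i ⁻¹' {0} : Set (∀ i, G ⧸ N i)) :=
      (isOpen_discrete _).preimage (continuous_apply i)
    exact ⟨_, hopen.mem_nhds rfl, fun x hx => hi ((QuotientAddGroup.eq_zero_iff x).mp hx)⟩

theorem isClosed_range_toPiQuotient [Preorder ι] (hopen : ∀ i, IsOpen (N i : Set G))
    (hanti : Antitone N)
    (hcoherent : ∀ x : ι → G, (∀ i j, i ≤ j → (x i : G ⧸ N i) = x j) →
      ∃ g : G, ∀ i, (g : G ⧸ N i) = x i) :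
    IsClosed (range (toPiQuotient N)) := by
  have hdiscrete (i : ι) : DiscreteTopology (G ⧸ N i) := QuotientAddGroup.discreteTopology (hopen i)
  refine isClosed_of_closure_subset fun y hy => ?_
  choose x hx using fun i => QuotientAddGroup.mk_surjective (y i)
  have hxcoherent (i j : ι) (hij : i ≤ j) : (x i : G ⧸ N i) = x j := by
    have hU : IsOpen ((fun z : ∀ i, G ⧸ N i => (z i, z j)) ⁻¹' {(y i, y j)}) :=
      (isOpen_discrete _).preimage ((continuous_apply i).prodMk (continuous_apply j))
    obtain ⟨_, hz, g, rfl⟩ := mem_closure_iff.mp hy _ hU rfl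
    obtain ⟨hgi, hgj⟩ : (g : G ⧸ N i) = y i ∧ (g : G ⧸ N j) = y j := Prod.ext_iff.mp hz
    rw [hx i, ← hgi]
    exact QuotientAddGroup.eq.mpr (hanti hij (QuotientAddGroup.eq.mp (hgj.trans (hx j).symm)))
  obtain ⟨g, hg⟩ := hcoherent x hxcoherent
  exact ⟨g, funext fun i => (hg i).trans (hx i)⟩

end PiQuotient

theorem exists_addSubgroup_eq_iInter_nhds_zero {G : Type*} [AddGroup G] [TopologicalSpace G]
    [IsTopologicalAddGroup G] {U : Set G} (hU : U ∈ 𝓝 0) :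
    ∃ (S : AddSubgroup G) (V : ℕ → Set G),
      (S : Set G) ⊆ U ∧ (∀ n, V n ∈ 𝓝 0) ∧ (S : Set G) = ⋂ n, V n := by
  have hhalf (V : {V : Set G // V ∈ 𝓝 0}) :
      ∃ W : {W : Set G // W ∈ 𝓝 0}, ∀ x ∈ W.1, ∀ y ∈ W.1, x - y ∈ V.1 := by
    obtain ⟨W, hW, hWV⟩ := exists_nhds_half_neg V.2
    exact ⟨⟨W, hW⟩, hWV⟩
  choose half hhalf using hhalf
  let V (n : ℕ) : {V : Set G // V ∈ 𝓝 0} := half^[n] ⟨U, hU⟩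
  have hV (n : ℕ) : ∀ x ∈ (V (n + 1)).1, ∀ y ∈ (V (n + 1)).1, x - y ∈ (V n).1 := by
    simp only [V, Function.iterate_succ_apply']
    exact hhalf _
  let S : AddSubgroup G :=
    AddSubgroup.ofSub (⋂ n, (V n).1) ⟨0, mem_iInter.mpr fun n => mem_of_mem_nhds (V n).2⟩
      fun {x} hx {y} hy => mem_iInter.mpr fun n => by
        simpa only [sub_eq_add_neg] using
          hV n x (mem_iInter.mp hx (n + 1)) y (mem_iInter.mp hy (n + 1))
  exact ⟨S, fun n => (V n).1, fun x hx => mem_iInter.mp hx 0, fun n => (V n).2, rfl⟩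

theorem exists_forall_ge_eq_of_forall_monotone {ι α : Type*} [Preorder ι] [Nonempty ι] {f : ι → α}
    (hf : ∀ c : ℕ → ι, Monotone c → ∃ n, f (c (n + 1)) = f (c n)) :
    ∃ i, ∀ j ≥ i, f j = f i := by
  by_contra! h
  choose next hle hne using h
  inhabit ι
  let c (n : ℕ) : ι := next^[n] default
  have hc (n : ℕ) : c (n + 1) = next (c n) := Function.iterate_succ_apply' next n default
  obtain ⟨n, hn⟩ := hf c (monotone_nat_of_le_succ fun n => (hc n).symm ▸ hle (c n))
  exact hne (c n) (hc n ▸ hn)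

namespace OnePointLindelofication

variable {D : Type u}

theorem isOpen_iff {U : Set (OnePointLindelofication D)} :
    IsOpen U ↔ (infty ∈ U → {d | pt d ∉ U}.Countable) :=
  Iff.rfl

theorem countable_setOf_pt_notMem {U : Set (OnePointLindelofication D)} (hU : U ∈ 𝓝 infty) :
    {d | pt d ∉ U}.Countable := by
  obtain ⟨V, hVU, hV, hmem⟩ := mem_nhds_iff.mp hU
  exact (isOpen_iff.mp hV hmem).mono fun d hd hdV => hd (hVU hdV)

open Classical in
/-- The retraction onto `C ∪ {x₀}` that sends every point outside `C` to `x₀`. -/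
noncomputable def retract (C : Set D) : OnePointLindelofication D → OnePointLindelofication D
  | pt d => if d ∈ C then pt d else infty
  | infty => infty

@[simp]
theorem retract_infty (C : Set D) : retract C infty = infty := rfl

theorem retract_pt_of_mem {C : Set D} {d : D} (hd : d ∈ C) : retract C (pt d) = pt d := if_pos hd

theorem retract_pt_of_notMem {C : Set D} {d : D} (hd : d ∉ C) : retract C (pt d) = infty :=
  if_neg hd

theorem retract_pt_eq_self_iff {C : Set D} {d : D} : retract C (pt d) = pt d ↔ d ∈ C := by
  simp [retract]

theorem retract_comp_retract (C C' : Set D) : retract C ∘ retract C' = retract (C ∩ C') := by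
  ext (d | _)
  · by_cases hC : d ∈ C <;> by_cases hC' : d ∈ C' <;> simp [retract, hC, hC']
  · rfl

theorem continuous_retract (C : Set D) : Continuous (retract C) := by
  refine ⟨fun U hU hinfty => Countable.mono (fun d hd => ?_) (hU hinfty)⟩
  refine fun hdU : pt d ∈ U => hd (?_ : retract C (pt d) ∈ U)
  by_cases hdC : d ∈ C
  · rwa [retract_pt_of_mem hdC]
  · rwa [retract_pt_of_notMem hdC]

theorem isLocallyConstant_retract {C : Set D} (hC : C.Countable) :
    IsLocallyConstant (retract C) := by
  refine fun s hinfty => hC.mono fun d hd => ?_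
  by_contra hdC
  exact hd (by rwa [mem_preimage, retract_pt_of_notMem hdC])

theorem countable_range_retract {C : Set D} (hC : C.Countable) : (range (retract C)).Countable := by
  refine ((hC.image pt).insert infty).mono (range_subset_iff.mpr ?_)
  rintro (d | _)
  · by_cases hd : d ∈ C
    · exact .inr ⟨d, hd, (retract_pt_of_mem hd).symm⟩
    · exact .inl (retract_pt_of_notMem hd)
  · exact .inl rfl

end OnePointLindelofication

namespace FreeAbelianTopGroup

open OnePointLindelofication

section Map

variable {X Y Z : Type u}

theorem of_injective : Function.Injective (of : X → FreeAbelianTopGroup X) :=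
  FreeAbelianGroup.of_injective

@[elab_as_elim]
theorem induction_on {p : FreeAbelianTopGroup X → Prop} (x : FreeAbelianTopGroup X)
    (zero : p 0) (of : ∀ x, p (of x)) (neg : ∀ x, p x → p (-x))
    (add : ∀ x y, p x → p y → p (x + y)) : p x :=
  FreeAbelianGroup.induction_on x zero of (fun x => neg (.of x)) add

instance [Countable X] : Countable (FreeAbelianTopGroup X) :=
  inferInstanceAs (Countable (FreeAbelianGroup X))

/-- The homomorphism of free abelian groups induced by a map of bases. -/
def map (f : X → Y) : FreeAbelianTopGroup X →+ FreeAbelianTopGroup Y :=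
  FreeAbelianGroup.map f

@[simp]
theorem map_of (f : X → Y) (x : X) : map f (of x) = of (f x) :=
  FreeAbelianGroup.map_of_apply x

theorem map_map (g : Y → Z) (f : X → Y) (x : FreeAbelianTopGroup X) :
    map g (map f x) = map (g ∘ f) x :=
  (FreeAbelianGroup.map_comp_apply x).symm

theorem countable_range_map {f : X → Y} (hf : (range f).Countable) :
    (range (map f)).Countable := by
  have := hf.to_subtype
  have hfactor : ⇑(map f) = map ((↑) : range f → Y) ∘ map (rangeFactorization f) := by
    ext x
    rw [Function.comp_apply, map_map]
    rfl
  exact (countable_range _).mono (hfactor ▸ range_comp_subset_range _ _)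

theorem sub_map_mem {f : X → X} {S : AddSubgroup (FreeAbelianTopGroup X)}
    (hS : ∀ x, of x - of (f x) ∈ S) (x : FreeAbelianTopGroup X) : x - map f x ∈ S := by
  induction x using induction_on with
  | zero => simp
  | of x => simpa using hS x
  | neg x hx => simpa only [map_neg, neg_sub_neg, neg_sub] using S.neg_mem hx
  | add x y hx hy => simpa only [map_add, add_sub_add_comm] using S.add_mem hx hy

end Map

section UniversalProperty

variable {X Y : Type u} [TopologicalSpace X] [TopologicalSpace Y] {A : Type*} [AddCommGroup A]

theorem continuous_of : Continuous (of : X → FreeAbelianTopGroup X) :=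
  AddGroupTopology.coinduced_continuous _

theorem continuous_of_continuous_comp_of [TopologicalSpace A] [IsTopologicalAddGroup A]
    (f : FreeAbelianTopGroup X →+ A) (hf : Continuous fun x => f (of x)) : Continuous f := by
  let t : AddGroupTopology (FreeAbelianTopGroup X) :=
    { toTopologicalSpace := TopologicalSpace.induced f inferInstance
      toIsTopologicalAddGroup := topologicalAddGroup_induced f }
  have hof : TopologicalSpace.coinduced of inferInstance ≤ t.toTopologicalSpace := by
    rw [← continuous_iff_coinduced_le, continuous_induced_rng]
    exact hf
  have ht : AddGroupTopology.coinduced (of : X → FreeAbelianTopGroup X) ≤ t := sInf_le hof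
  exact continuous_iff_le_induced.mpr ht

theorem continuous_map {f : X → Y} (hf : Continuous f) : Continuous (map f) :=
  continuous_of_continuous_comp_of _ (by simpa only [map_of] using! continuous_of.comp hf)

theorem isOpen_ker (f : FreeAbelianTopGroup X →+ A) (hf : IsLocallyConstant fun x => f (of x)) :
    IsOpen (f.ker : Set (FreeAbelianTopGroup X)) := by
  let : TopologicalSpace A := ⊥
  have : DiscreteTopology A := ⟨rfl⟩
  exact (isOpen_discrete {(0 : A)}).preimage (continuous_of_continuous_comp_of f hf.continuous)

end UniversalProperty

section Collapse

variable {D : Type u}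

local notation "H" => FreeAbelianTopGroup (OnePointLindelofication D)

/-- The endomorphism of the free abelian group on `D ∪ {x₀}` that identifies every point outside
`C` with `x₀`. -/
noncomputable def collapse (C : Set D) : H →+ H :=
  map (retract C)

theorem collapse_of (C : Set D) (x : OnePointLindelofication D) :
    collapse C (of x) = of (retract C x) :=
  map_of _ _

theorem collapse_collapse (C C' : Set D) (x : H) :
    collapse C (collapse C' x) = collapse (C ∩ C') x := by
  rw [collapse, collapse, collapse, map_map, retract_comp_retract]

theorem continuous_collapse (C : Set D) : Continuous (collapse C) :=
  continuous_map (continuous_retract C)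

theorem collapse_eq_self_of_subset {C C' : Set D} (h : C ⊆ C') {x : H} (hx : collapse C x = x) :
    collapse C' x = x := by
  rw [← hx, collapse_collapse, inter_eq_self_of_subset_right h]

theorem exists_finite_collapse_eq_self (x : H) : ∃ F : Set D, F.Finite ∧ collapse F x = x := by
  induction x using induction_on with
  | zero => exact ⟨∅, finite_empty, map_zero _⟩
  | of x =>
    rcases x with d | _
    · exact ⟨{d}, finite_singleton d, by rw [collapse_of, retract_pt_of_mem (mem_singleton d)]⟩
    · exact ⟨∅, finite_empty, collapse_of _ _⟩
  | neg x hx =>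
    obtain ⟨F, hF, hFx⟩ := hx
    exact ⟨F, hF, by rw [map_neg, hFx]⟩
  | add x y hx hy =>
    obtain ⟨F, hF, hFx⟩ := hx
    obtain ⟨F', hF', hFy⟩ := hy
    refine ⟨F ∪ F', hF.union hF', ?_⟩
    rw [map_add, collapse_eq_self_of_subset subset_union_left hFx,
      collapse_eq_self_of_subset subset_union_right hFy]

theorem exists_forall_ge_collapse_eq_collapse_iUnion {c : ℕ → Set D} (hc : Monotone c) (x : H) :
    ∃ n, ∀ m ≥ n, collapse (c m) x = collapse (⋃ n, c n) x := by
  obtain ⟨F, hF, hFx⟩ := exists_finite_collapse_eq_self x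
  obtain ⟨n, hn⟩ : ∃ n, (⋃ n, c n) ∩ F ⊆ c n := by
    have hfinite : ((⋃ n, c n) ∩ F).Finite := hF.inter_of_right _
    rw [← hfinite.coe_toFinset]
    exact hc.directed_le.exists_mem_subset_of_finset_subset_biUnion
      (hfinite.coe_toFinset.subset.trans inter_subset_left)
  refine ⟨n, fun m hm => ?_⟩
  have hinter : c m ∩ F = (⋃ n, c n) ∩ F :=
    (inter_subset_inter_left F (subset_iUnion c m)).antisymm
      (subset_inter (hn.trans (hc hm)) inter_subset_right)
  rw [← hFx, collapse_collapse, collapse_collapse, hinter]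

/-- The kernel of `collapse C`. These subgroups, for `C` countable, are open and form a base at
zero; the index type is ordered by inclusion, which makes the family antitone. -/
noncomputable def tail (C : {C : Set D // C.Countable}) : AddSubgroup H :=
  (collapse C.1).ker

theorem mk_tail_eq_iff {C : {C : Set D // C.Countable}} {x y : H} :
    (x : H ⧸ tail C) = y ↔ collapse C.1 x = collapse C.1 y := by
  rw [QuotientAddGroup.eq, tail, AddMonoidHom.mem_ker, map_add, map_neg, neg_add_eq_zero]

theorem antitone_tail : Antitone (tail (D := D)) := by
  intro C C' hCC' x hx
  rw [tail, AddMonoidHom.mem_ker] at hx ⊢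
  rw [← inter_eq_self_of_subset_left hCC', ← collapse_collapse, hx, map_zero]

theorem isOpen_tail (C : {C : Set D // C.Countable}) : IsOpen (tail C : Set H) :=
  isOpen_ker _ (by simpa only [collapse_of] using! (isLocallyConstant_retract C.2).comp of)

theorem countable_quotient_tail (C : {C : Set D // C.Countable}) : Countable (H ⧸ tail C) := by
  have : Countable (collapse C.1).range :=
    (countable_range_map (countable_range_retract C.2)).to_subtype
  exact (QuotientAddGroup.quotientKerEquivRange (collapse C.1)).injective.countable

theorem countable_setOf_sub_of_infty_notMem {V : Set H} (hV : V ∈ 𝓝 0) :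
    {d : D | of (pt d) - of infty ∉ V}.Countable := by
  let f (x : OnePointLindelofication D) : H := of x - of infty
  have hcont : Continuous f := continuous_of.sub continuous_const
  have hzero : Tendsto f (𝓝 infty) (𝓝 0) := by
    simpa only [f, sub_self] using hcont.tendsto infty
  exact countable_setOf_pt_notMem (hzero hV)

theorem tail_le {C : {C : Set D // C.Countable}} {S : AddSubgroup H}
    (hS : ∀ d ∉ C.1, of (pt d) - of infty ∈ S) : tail C ≤ S := by
  intro x hx
  have hgen (y : OnePointLindelofication D) : of y - of (retract C.1 y) ∈ S := by
    rcases y with d | _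
    · by_cases hd : d ∈ C.1
      · simp only [retract_pt_of_mem hd, sub_self, zero_mem]
      · simpa only [retract_pt_of_notMem hd] using hS d hd
    · simp only [retract_infty, sub_self, zero_mem]
  have hker : map (retract C.1) x = 0 := hx
  simpa only [hker, sub_zero] using sub_map_mem hgen x

theorem hasBasis_nhds_zero :
    (𝓝 (0 : H)).HasBasis (fun _ : {C : Set D // C.Countable} => True)
      fun C => (tail C : Set H) := by
  refine ⟨fun U => ⟨fun hU => ?_, ?_⟩⟩
  · obtain ⟨S, V, hSU, hV, hSV⟩ := exists_addSubgroup_eq_iInter_nhds_zero hU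
    have hC : {d : D | of (pt d) - of infty ∉ S}.Countable := by
      refine (countable_iUnion fun n => countable_setOf_sub_of_infty_notMem (hV n)).mono ?_
      intro d hd
      simpa only [← SetLike.mem_coe, hSV, mem_iInter, not_forall, mem_ofPred_eq,
        mem_iUnion] using hd
    have hle : tail ⟨_, hC⟩ ≤ S := tail_le fun d hd => not_not.mp hd
    exact ⟨_, trivial, fun x hx => hSU (hle hx)⟩
  · rintro ⟨C, -, hCU⟩
    exact mem_of_superset ((isOpen_tail C).mem_nhds (zero_mem _)) hCU

theorem exists_forall_ge_collapse_eq {x : {C : Set D // C.Countable} → H}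
    (hx : ∀ C C', C ≤ C' → collapse C.1 (x C) = collapse C.1 (x C')) :
    ∃ C, ∀ C' ≥ C, collapse C'.1 (x C') = collapse C.1 (x C) := by
  have : Nonempty {C : Set D // C.Countable} := ⟨⟨∅, countable_empty⟩⟩
  let y (C : {C : Set D // C.Countable}) : H := collapse C.1 (x C)
  refine exists_forall_ge_eq_of_forall_monotone (f := y) fun c hc => ?_
  let S : {C : Set D // C.Countable} := ⟨⋃ n, (c n).1, countable_iUnion fun n => (c n).2⟩
  obtain ⟨n, hn⟩ : ∃ n, ∀ m ≥ n, collapse (c m).1 (x S) = collapse S.1 (x S) :=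
    exists_forall_ge_collapse_eq_collapse_iUnion (fun _ _ h => hc h) (x S)
  have hS (m : ℕ) : collapse (c m).1 (x (c m)) = collapse (c m).1 (x S) :=
    hx (c m) S (subset_iUnion (fun n => (c n).1) m)
  have hstable : ∀ m ≥ n, collapse (c m).1 (x (c m)) = collapse S.1 (x S) :=
    fun m hm => (hS m).trans (hn m hm)
  exact ⟨n, (hstable (n + 1) n.le_succ).trans (hstable n le_rfl).symm⟩

theorem exists_forall_mk_tail_eq {x : {C : Set D // C.Countable} → H}
    (hx : ∀ C C', C ≤ C' → (x C : H ⧸ tail C) = x C') : ∃ g : H, ∀ C, (g : H ⧸ tail C) = x C := by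
  simp only [mk_tail_eq_iff] at hx ⊢
  obtain ⟨C₀, hC₀⟩ := exists_forall_ge_collapse_eq hx
  refine ⟨collapse C₀.1 (x C₀), fun C => ?_⟩
  let E : {C : Set D // C.Countable} := ⟨C.1 ∪ C₀.1, C.2.union C₀.2⟩
  calc collapse C.1 (collapse C₀.1 (x C₀))
      = collapse C.1 (collapse E.1 (x E)) := by rw [hC₀ E subset_union_right]
    _ = collapse C.1 (x E) := by
        rw [collapse_collapse, inter_eq_self_of_subset_left subset_union_left]
    _ = collapse C.1 (x C) := (hx C E subset_union_left).symm

theorem toPiQuotient_tail_injective : Function.Injective (toPiQuotient (tail (D := D))) := by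
  refine (injective_iff_map_eq_zero _).mpr fun x hx => ?_
  obtain ⟨F, hF, hFx⟩ := exists_finite_collapse_eq_self x
  have hker : x ∈ tail ⟨F, hF.countable⟩ := (QuotientAddGroup.eq_zero_iff x).mp (congrFun hx _)
  exact hFx.symm.trans hker

theorem isClosedEmbedding_toPiQuotient_tail : IsClosedEmbedding (toPiQuotient (tail (D := D))) where
  toIsInducing := isInducing_toPiQuotient hasBasis_nhds_zero
  injective := toPiQuotient_tail_injective
  isClosed_range :=
    isClosed_range_toPiQuotient isOpen_tail antitone_tail fun _ => exists_forall_mk_tail_eq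

instance : T2Space H :=
  have (C : {C : Set D // C.Countable}) : DiscreteTopology (H ⧸ tail C) :=
    QuotientAddGroup.discreteTopology (isOpen_tail C)
  isClosedEmbedding_toPiQuotient_tail.isEmbedding.t2Space

theorem countable_of_separableSpace [SeparableSpace H] : Countable D := by
  obtain ⟨s, hs, hdense⟩ := exists_countable_dense H
  choose F hF hFx using exists_finite_collapse_eq_self (D := D)
  let C : Set D := ⋃ x ∈ s, F x
  have hC : C.Countable := hs.biUnion fun x _ => (hF x).countable
  have hid : ⇑(collapse C) = id :=
    (continuous_collapse C).ext_on hdense continuous_id fun x hx =>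
      collapse_eq_self_of_subset (subset_biUnion_of_mem hx) (hFx x)
  refine countable_univ_iff.mp (hC.mono fun d _ => retract_pt_eq_self_iff.mp (of_injective ?_))
  rw [← collapse_of, hid, id]

end Collapse

end FreeAbelianTopGroup

open FreeAbelianTopGroup

theorem mainTheorem9_general (D : Type u) [Uncountable D] (hD : #D ≤ 𝔠) :
    ∃ (G : Type u) (_ : AddCommGroup G) (_ : TopologicalSpace G) (_ : IsTopologicalAddGroup G),
      SeparableSpace G ∧ IsProdiscrete G ∧ IsProLie G ∧
        ∃ K : AddSubgroup G,
          IsClosed (K : Set G) ∧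
          ¬ SeparableSpace K ∧
          Nonempty (FreeAbelianTopGroup (OnePointLindelofication D) ≃ₜ+ K) := by
  let H := FreeAbelianTopGroup (OnePointLindelofication D)
  let ι := {C : Set D // C.Countable}
  have (C : ι) : DiscreteTopology (H ⧸ tail C) := QuotientAddGroup.discreteTopology (isOpen_tail C)
  have (C : ι) : Countable (H ⧸ tail C) := countable_quotient_tail C
  let E : H ≃ₜ+ (toPiQuotient (tail (D := D))).range :=
    .mk' isClosedEmbedding_toPiQuotient_tail.isEmbedding.toHomeomorph fun x y =>
      Subtype.ext (map_add (toPiQuotient tail) x y)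
  refine ⟨∀ C : ι, H ⧸ tail C, inferInstance, inferInstance, inferInstance,
    separableSpace_pi_of_mk_le_continuum (mk_setOf_countable_le_continuum hD),
    .pi fun _ => .of_discreteTopology, isProLie_pi_of_discreteTopology _,
    (toPiQuotient tail).range, isClosedEmbedding_toPiQuotient_tail.isClosed_range,
    fun _ => ?_, ⟨E⟩⟩
  have : SeparableSpace H := E.symm.surjective.denseRange.separableSpace E.symm.continuous
  exact not_countable (α := D) countable_of_separableSpace

theorem mainTheorem9 (D : Type u) (hD : Cardinal.mk D = Cardinal.aleph 1) :
    ∃ (G : Type u) (_ : AddCommGroup G) (_ : TopologicalSpace G) (_ : IsTopologicalAddGroup G),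
      TopologicalSpace.SeparableSpace G ∧ IsProdiscrete G ∧ IsProLie G ∧
        ∃ K : AddSubgroup G,
          IsClosed (K : Set G) ∧
          ¬ TopologicalSpace.SeparableSpace K ∧
          Nonempty (FreeAbelianTopGroup (OnePointLindelofication D) ≃ₜ+ K) := by
  have : Uncountable D := by
    rw [← Cardinal.aleph0_lt_mk_iff, hD]
    exact Cardinal.aleph0_lt_aleph_one
  exact mainTheorem9_general D (hD.trans_le Cardinal.aleph_one_le_continuum)
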